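/- Let a topological group $G$ act continuously on a topological space $X$ (i.e. the action map $G\times X\to X$ is jointly continuous). An \emph{equivariant compactification} of $X$ is a compact Hausdorff space $K$ with a (jointly) continuous action of $G$, together with a continuous $G$-equivariant map $i\colon X\to K$ whose image is dense in $K$; the map $i$ is not required to be injective or an embedding. Theorem. There exist a countable (in particular separable) metrizable topological group $G$ and a continuous action of $G$ on the space $\mathbb{Q}$ of rational numbers with its usual topology such that every equivariant compactification of $\mathbb{Q}$ is a singleton. -/

import Mathlib

universe u

/-- Let the topological group `G` act on the topological space `X`. A space `K` with an action
of `G`, together with a map `i : X → K`, is an *equivariant compactification* of `X` if `K` is a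
compact Hausdorff space, the action map `G × K → K` is (jointly) continuous, and `i` is a
continuous `G`-equivariant map with dense image. The map `i` need be neither injective nor a
topological embedding. -/
structure IsEquivariantCompactification (G : Type*) [Group G] [TopologicalSpace G]
    {X : Type*} [TopologicalSpace X] [MulAction G X]
    {K : Type*} [TopologicalSpace K] [MulAction G K] (i : X → K) : Prop where
  compactSpace : CompactSpace K
  t2Space : T2Space K
  continuousSMul : ContinuousSMul G K
  continuous : Continuous i
  equivariant : ∀ (g : G) (x : X), i (g • x) = g • i x
  denseRange : DenseRange i

/-!
# A group acting on the rationals without nontrivial equivariant compactifications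

The space is a countable metrizable space `Word` without isolated points, which is homeomorphic to
`ℚ` by Sierpiński's theorem (`nonempty_homeomorph_rat`). Its points are finite words over the
letters `(n, i, k) : ℕ × ℤ × ℕ∞`. To each word `w` a fan is attached, with one spike for each `n`
and with a copy of `ℤ × ℕ∞` as spike, consisting of the words `(n, i, k) :: w`. As the height `i`
tends to `-∞`, these words converge to `w`, and as it tends to `+∞`, they converge to the empty
word, the root; both limits are uniform in `n` (`Word.tendsto_cons_atBot`,
`Word.tendsto_cons_atTop`). On each spike, the columns `k < ⊤` converge to the column `⊤` of nodes.

In a column `k < ⊤`, the flip `singleFlip n k` exchanges the heights `i` and `i + 1` whenever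
`i + k` is even, simultaneously in all fans. These commuting involutions generate the countable
group `FlipGroup`, in which the flips on spikes with large label `n` are close to the identity.
The action on words is jointly continuous since a flip changes heights by at most one
(`truncate_map_smul`).

Let `φ` be a function on words that is induced by a continuous function on an equivariant
compactification. By compactness, group elements close to the identity change `φ` uniformly little
(`isSlowlyMoved_comp`). For large `n` the function `φ` therefore takes almost the same value at the
heights `i` and `i + 1` of a column of suitable parity, and, letting the column tend to `⊤`, at the
nodes `i` and `i + 1` of the `n`-th spike. This error tends to zero as `n → ∞`. A number of steps
which does not depend on `n` leads from a node close to `w` to a node close to the root, so that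
`φ w` is the value of `φ` at the root (`IsSlowlyMoved.eq_root`). Hence the compactification is a
single point.
-/

open Set Filter Topology TopologicalSpace

/-! ### Countable metrizable spaces without isolated points -/

/-- Two points of a coding `Φ : X → 2^ℕ` agree below `n`. -/
def AgreeBelow {X : Type*} (Φ : X → ℕ → Bool) (n : ℕ) (x y : X) : Prop :=
  ∀ m < n, Φ y m = Φ x m

/-- If a coding of a countable space by binary sequences induces the topology, has a range in
which every finite prefix can be continued by both digits, and avoids the eventually constant
sequences, then the lexicographic order makes the space a countable dense linear order without
endpoints, and the topology is the order topology. Cantor's theorem does the rest. -/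
theorem nonempty_homeomorph_rat_of_coding {X : Type*} [TopologicalSpace X] [Countable X]
    [Nonempty X] (Φ : X → ℕ → Bool) (hinj : Function.Injective Φ)
    (hnhds : ∀ x, (𝓝 x).HasBasis (fun _ : ℕ => True) fun n => {y | AgreeBelow Φ n x y})
    (hsplit : ∀ x n b, ∃ y, AgreeBelow Φ n x y ∧ Φ y n = b)
    (hosc : ∀ x n b, ∃ m ≥ n, Φ x m = b) : Nonempty (X ≃ₜ ℚ) := by
  let : LinearOrder X := LinearOrder.lift' (fun x => toLex (Φ x)) (fun a b hab => hinj hab)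
  have hlt : ∀ x y : X, x < y ↔ ∃ n, (∀ m < n, Φ x m = Φ y m) ∧ Φ x n < Φ y n :=
    fun x y => Iff.rfl
  -- Switching a late digit `false` of `x` to `true` yields a larger point `z` such that all points
  -- between `x` and `z` have a long prefix in common with `x`.
  have hup : ∀ x n, ∃ z, x < z ∧ AgreeBelow Φ n x z ∧ ∀ y, x ≤ y → y ≤ z → AgreeBelow Φ n x y := by
    intro x n
    obtain ⟨m, hm, hxm⟩ := hosc x n false
    obtain ⟨z, hz, hzm⟩ := hsplit x m true
    refine ⟨z, (hlt x z).2 ⟨m, fun k hk => (hz k hk).symm, by simp [hxm, hzm]⟩,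
      fun k hk => hz k (hk.trans_le hm), fun y hxy hyz => ?_⟩
    intro k hk
    induction k using Nat.strong_induction_on with
    | _ k ih =>
      by_contra hne
      have hzk := hz k (hk.trans_le hm)
      rcases lt_or_gt_of_ne hne with h | h
      · exact not_lt_of_ge hxy ((hlt y x).2 ⟨k, fun j hj => ih j hj (hj.trans hk), h⟩)
      · refine not_lt_of_ge hyz ((hlt z y).2 ⟨k, fun j hj => ?_, by rwa [hzk]⟩)
        rw [hz j ((hj.trans hk).trans_le hm), ih j hj (hj.trans hk)]
  have hdown : ∀ x n, ∃ z, z < x ∧ AgreeBelow Φ n x z ∧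
      ∀ y, z ≤ y → y ≤ x → AgreeBelow Φ n x y := by
    intro x n
    obtain ⟨m, hm, hxm⟩ := hosc x n true
    obtain ⟨z, hz, hzm⟩ := hsplit x m false
    refine ⟨z, (hlt z x).2 ⟨m, hz, by simp [hxm, hzm]⟩,
      fun k hk => hz k (hk.trans_le hm), fun y hzy hyx => ?_⟩
    intro k hk
    induction k using Nat.strong_induction_on with
    | _ k ih =>
      by_contra hne
      have hzk := hz k (hk.trans_le hm)
      rcases lt_or_gt_of_ne hne with h | h
      · refine not_lt_of_ge hzy ((hlt y z).2 ⟨k, fun j hj => ?_, by rwa [hzk]⟩)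
        rw [hz j ((hj.trans hk).trans_le hm), ih j hj (hj.trans hk)]
      · exact not_lt_of_ge hyx
          ((hlt x y).2 ⟨k, fun j hj => (ih j hj (hj.trans hk)).symm, h⟩)
  have : NoMaxOrder X := ⟨fun x => (hup x 0).imp fun z hz => hz.1⟩
  have : NoMinOrder X := ⟨fun x => (hdown x 0).imp fun z hz => hz.1⟩
  have : DenselyOrdered X := by
    refine ⟨fun x y hxy => ?_⟩
    obtain ⟨n, hn, hn'⟩ := (hlt x y).1 hxy
    obtain ⟨z, hxz, hz, -⟩ := hup x (n + 1)
    refine ⟨z, hxz, (hlt z y).2 ⟨n, fun m hm => ?_, ?_⟩⟩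
    · rw [hz m (by omega), hn m hm]
    · rwa [hz n (by omega)]
  have : OrderTopology X := by
    refine ⟨le_antisymm (le_generateFrom ?_) ?_⟩
    · rintro s ⟨a, rfl | rfl⟩
      · refine isOpen_iff_mem_nhds.2 fun x hx => ?_
        obtain ⟨n, hn, hn'⟩ := (hlt a x).1 hx
        refine (hnhds x).mem_of_superset (i := n + 1) trivial fun y hy => (hlt a y).2 ⟨n, ?_, ?_⟩
        · intro m hm
          rw [hy m (by omega), hn m hm]
        · rwa [hy n (by omega)]
      · refine isOpen_iff_mem_nhds.2 fun x hx => ?_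
        obtain ⟨n, hn, hn'⟩ := (hlt x a).1 hx
        refine (hnhds x).mem_of_superset (i := n + 1) trivial fun y hy => (hlt y a).2 ⟨n, ?_, ?_⟩
        · intro m hm
          rw [hy m (by omega), hn m hm]
        · rwa [hy n (by omega)]
    · intro U hU
      have hU' : ∀ x ∈ U, ∃ n, {y | AgreeBelow Φ n x y} ⊆ U := fun x hx => by
        simpa using (hnhds x).mem_iff.1 (hU.mem_nhds hx)
      let : TopologicalSpace X := Preorder.topology X
      have : OrderTopology X := ⟨rfl⟩
      change IsOpen U
      refine isOpen_iff_mem_nhds.2 fun x hx => ?_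
      obtain ⟨n, hn⟩ := hU' x hx
      obtain ⟨a, hax, -, ha⟩ := hdown x n
      obtain ⟨b, hxb, -, hb⟩ := hup x n
      refine mem_of_superset (Ioo_mem_nhds hax hxb) fun y hy => hn ?_
      rcases le_total x y with h | h
      · exact hb y h hy.2.le
      · exact ha y hy.1.le h
  obtain ⟨e⟩ := Order.iso_of_countable_dense X ℚ
  exact ⟨e.toHomeomorph⟩

/-- The hypothesis on eventually constant codes is harmless: adding a suitable fixed binary
sequence modulo two to all codes achieves it. -/
theorem nonempty_homeomorph_rat_of_splitting {X : Type*} [TopologicalSpace X] [Countable X]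
    [Nonempty X] (Φ : X → ℕ → Bool) (hinj : Function.Injective Φ)
    (hnhds : ∀ x, (𝓝 x).HasBasis (fun _ : ℕ => True) fun n => {y | AgreeBelow Φ n x y})
    (hsplit : ∀ x n b, ∃ y, AgreeBelow Φ n x y ∧ Φ y n = b) : Nonempty (X ≃ₜ ℚ) := by
  obtain ⟨u, hu⟩ := exists_surjective_nat X
  -- At the position coded by the pair `(e, r)`, the new code of the `e`-th point is the parity
  -- of `r`.
  let c : ℕ → Bool := fun m => xor (Φ (u m.unpair.1) m) (decide (m.unpair.2 % 2 = 1))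
  let Ψ : X → ℕ → Bool := fun x m => xor (Φ x m) (c m)
  have hagree : ∀ n x y, AgreeBelow Ψ n x y ↔ AgreeBelow Φ n x y := by
    intro n x y
    simp [AgreeBelow, Ψ]
  refine nonempty_homeomorph_rat_of_coding Ψ ?_ ?_ ?_ ?_
  · intro x y hxy
    apply hinj
    funext m
    simpa [Ψ] using congrFun hxy m
  · simpa only [hagree] using hnhds
  · intro x n b
    obtain ⟨y, hy, hyn⟩ := hsplit x n (xor b (c n))
    exact ⟨y, (hagree n x y).2 hy, by simp [Ψ, hyn]⟩
  · intro x n b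
    obtain ⟨e, rfl⟩ := hu x
    refine ⟨Nat.pair e (2 * n + b.toNat), ?_, ?_⟩
    · exact le_trans (by omega) (Nat.right_le_pair e (2 * n + b.toNat))
    · cases b <;> simp [Ψ, c]

/-- A countable metrizable space has a base of clopen sets: all but countably many radii are not
attained by the distance to a given point. -/
theorem isTopologicalBasis_isClopen_of_countable (X : Type*) [TopologicalSpace X] [Countable X]
    [MetrizableSpace X] : IsTopologicalBasis {s : Set X | IsClopen s} := by
  let := metrizableSpaceMetric X
  refine isTopologicalBasis_of_isOpen_of_nhds (fun s hs => hs.isOpen) fun x U hx hU => ?_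
  obtain ⟨ε, hε, hεU⟩ := Metric.isOpen_iff.1 hU x hx
  obtain ⟨r, hr, h0r, hrε⟩ :=
    ((countable_range fun y => dist y x).dense_compl ℝ).exists_between hε
  have hball : Metric.ball x r = Metric.closedBall x r := by
    ext y
    simp only [Metric.mem_ball, Metric.mem_closedBall]
    exact ⟨le_of_lt, fun h => lt_of_le_of_ne h fun h' => hr ⟨y, h'⟩⟩
  exact ⟨Metric.ball x r, ⟨hball ▸ Metric.isClosed_closedBall, Metric.isOpen_ball⟩,
    Metric.mem_ball_self h0r, (Metric.ball_subset_ball hrε.le).trans hεU⟩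

/-- The atom containing `x` of the `n`-th partition in a sequence of finer and finer partitions:
each atom `A` of the `n`-th partition is cut by the set `S A n`. -/
def splittingAtom {X : Type*} (S : Set X → ℕ → Set X) : ℕ → X → Set X
  | 0, _ => univ
  | n + 1, x => {y | y ∈ splittingAtom S n x ∧
      (y ∈ S (splittingAtom S n x) n ↔ x ∈ S (splittingAtom S n x) n)}

/-- The digits of a point record on which side of each cut it lies. -/
noncomputable def splittingCode {X : Type*} (S : Set X → ℕ → Set X) (x : X) (n : ℕ) : Bool :=
  open Classical in decide (x ∈ S (splittingAtom S n x) n)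

theorem splittingAtom_eq_and_mem_iff {X : Type*} (S : Set X → ℕ → Set X) (n : ℕ) (x y : X) :
    (y ∈ splittingAtom S n x ↔ AgreeBelow (splittingCode S) n x y) ∧
      (y ∈ splittingAtom S n x → splittingAtom S n y = splittingAtom S n x) := by
  induction n with
  | zero => simp [splittingAtom, AgreeBelow]
  | succ n ih =>
    have h : y ∈ splittingAtom S (n + 1) x ↔ AgreeBelow (splittingCode S) (n + 1) x y := by
      simp only [splittingAtom, mem_ofPred_eq, AgreeBelow, Nat.forall_lt_succ_right]
      rw [ih.1]
      refine and_congr_right fun hy => ?_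
      simp [splittingCode, ih.2 (ih.1.2 hy)]
    refine ⟨h, fun hy => ?_⟩
    simp only [splittingAtom, mem_ofPred_eq] at hy ⊢
    rw [ih.2 hy.1]
    simp [hy.2]

theorem isClopen_splittingAtom {X : Type*} [TopologicalSpace X] {S : Set X → ℕ → Set X}
    (hS : ∀ A n, IsClopen (S A n)) (n : ℕ) (x : X) : IsClopen (splittingAtom S n x) := by
  induction n with
  | zero => exact isClopen_univ
  | succ n ih =>
    by_cases hx : x ∈ S (splittingAtom S n x) n
    · simpa [splittingAtom, hx, ofPred_and] using ih.inter (hS _ n)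
    · have h : splittingAtom S (n + 1) x = splittingAtom S n x \ S (splittingAtom S n x) n := by
        ext y
        simp [splittingAtom, hx]
      exact h ▸ ih.diff (hS _ n)

/-- **Sierpiński's theorem**: every nonempty countable metrizable space without isolated points is
homeomorphic to the space of rational numbers. -/
theorem nonempty_homeomorph_rat (X : Type*) [TopologicalSpace X] [Countable X] [Nonempty X]
    [MetrizableSpace X] [∀ x : X, NeBot (𝓝[≠] x)] : Nonempty (X ≃ₜ ℚ) := by
  have hbasis := isTopologicalBasis_isClopen_of_countable X
  obtain ⟨t, htc, htcount, ht⟩ := hbasis.exists_countable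
  have htne : t.Nonempty := by
    obtain ⟨x⟩ := ‹Nonempty X›
    obtain ⟨s, hs, -⟩ := ht.exists_subset_of_mem_open (mem_univ x) isOpen_univ
    exact ⟨s, hs⟩
  obtain ⟨B, rfl⟩ := htcount.exists_eq_range htne
  have hB : ∀ n, IsClopen (B n) := fun n => htc ⟨n, rfl⟩
  -- Cut by the `n`-th basic set where that is possible, and otherwise in an arbitrary way.
  have hcut : ∀ (A : Set X) (n : ℕ), ∃ s, IsClopen s ∧
      (IsOpen A → A.Nonempty → (A ∩ s).Nonempty ∧ (A \ s).Nonempty ∧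
        ((A ∩ B n).Nonempty → (A \ B n).Nonempty → s = B n)) := by
    intro A n
    by_cases h : (A ∩ B n).Nonempty ∧ (A \ B n).Nonempty
    · exact ⟨B n, hB n, fun _ _ => ⟨h.1, h.2, fun _ _ => rfl⟩⟩
    by_cases hA : IsOpen A ∧ A.Nonempty
    · obtain ⟨hAo, x, hx⟩ := hA
      obtain ⟨y, hy, hyx⟩ : ∃ y ∈ A, y ≠ x := by
        have := (inferInstance : NeBot (𝓝[≠] x)).nonempty_of_mem
          (inter_mem_nhdsWithin _ (hAo.mem_nhds hx))
        exact this.imp fun y hy => ⟨hy.2, hy.1⟩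
      obtain ⟨s, hs, hxs, hsy⟩ := hbasis.exists_subset_of_mem_open
        (show x ∈ ({y}ᶜ : Set X) from fun h' => hyx h'.symm) isOpen_compl_singleton
      exact ⟨s, hs, fun _ _ => ⟨⟨x, hx, hxs⟩, ⟨y, hy, fun h' => hsy h' rfl⟩,
        fun h1 h2 => absurd ⟨h1, h2⟩ h⟩⟩
    · exact ⟨∅, isClopen_empty, fun h1 h2 => absurd ⟨h1, h2⟩ hA⟩
  choose S hS hSA using hcut
  have hmem : ∀ n x, x ∈ splittingAtom S n x := fun n x =>
    (splittingAtom_eq_and_mem_iff S n x x).1.2 fun _ _ => rfl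
  have hSA' : ∀ n x, _ := fun n x => hSA (splittingAtom S n x) n
    (isClopen_splittingAtom hS n x).isOpen ⟨x, hmem n x⟩
  have hatom : ∀ n x, {y | AgreeBelow (splittingCode S) n x y} = splittingAtom S n x :=
    fun n x => Set.ext fun y => (splittingAtom_eq_and_mem_iff S n x y).1.symm
  have hnhds : ∀ x, (𝓝 x).HasBasis (fun _ : ℕ => True)
      fun n => {y | AgreeBelow (splittingCode S) n x y} := by
    intro x
    refine ⟨fun U => ⟨fun hU => ?_, fun ⟨n, _, hn⟩ => mem_of_superset ?_ hn⟩⟩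
    · obtain ⟨_, ⟨n, rfl⟩, hx, hU⟩ := ht.mem_nhds_iff.1 hU
      refine ⟨n + 1, trivial, ?_⟩
      rw [hatom]
      rintro y ⟨hy, hyS⟩
      apply hU
      by_contra hyB
      have hSB := (hSA' n x).2.2 ⟨x, hmem n x, hx⟩ ⟨y, hy, hyB⟩
      rw [hSB] at hyS
      exact hyB (hyS.2 hx)
    · rw [hatom]
      exact (isClopen_splittingAtom hS n x).isOpen.mem_nhds (hmem n x)
  refine nonempty_homeomorph_rat_of_splitting (splittingCode S) ?_ hnhds ?_
  · intro x y hxy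
    by_contra hne
    obtain ⟨n, -, hn⟩ := (hnhds x).mem_iff.1 (isOpen_compl_singleton.mem_nhds hne)
    exact hn (show AgreeBelow _ n x y from fun m _ => by rw [hxy]) rfl
  · intro x n b
    obtain ⟨⟨y, hy, hyS⟩, ⟨z, hz, hzS⟩, -⟩ := hSA' n x
    have h := splittingAtom_eq_and_mem_iff S n x
    cases b
    · refine ⟨z, (h z).1.1 hz, ?_⟩
      simp [splittingCode, (h z).2 hz, hzS]
    · refine ⟨y, (h y).1.1 hy, ?_⟩
      simp [splittingCode, (h y).2 hy, hyS]

/-! ### Topology on lists -/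

theorem List.nhds_cons_eq_map {α : Type*} [TopologicalSpace α] (a : α) (l : List α) :
    𝓝 (a :: l) = Filter.map (fun p : α × List α => p.1 :: p.2) (𝓝 a ×ˢ 𝓝 l) := by
  rw [nhds_cons, Filter.map_prod]
  rfl

theorem List.isClosed_image2_cons {α : Type*} [TopologicalSpace α] {s : Set α} {t : Set (List α)}
    (hs : IsClosed s) (ht : IsClosed t) : IsClosed (image2 List.cons s t) := by
  rw [← isOpen_compl_iff, isOpen_iff_mem_nhds]
  rintro (_ | ⟨a, l⟩) h
  · rw [nhds_nil]
    exact h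
  · rw [List.nhds_cons_eq_map, Filter.mem_map]
    have h' : a ∉ s ∨ l ∉ t := by
      by_contra! h'
      exact h ⟨a, h'.1, l, h'.2, rfl⟩
    rcases h' with h' | h'
    · filter_upwards [prod_mem_prod (hs.isOpen_compl.mem_nhds h') univ_mem] with p hp
      rintro ⟨b, hb, m, hm, hbm⟩
      obtain ⟨rfl, rfl⟩ := List.cons.inj hbm
      exact hp.1 hb
    · filter_upwards [prod_mem_prod univ_mem (ht.isOpen_compl.mem_nhds h')] with p hp
      rintro ⟨b, hb, m, hm, hbm⟩
      obtain ⟨rfl, rfl⟩ := List.cons.inj hbm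
      exact hp.2 hm

theorem List.isClosed_singleton_nil {α : Type*} [TopologicalSpace α] :
    IsClosed ({[]} : Set (List α)) := by
  rw [← isOpen_compl_iff, isOpen_iff_mem_nhds]
  rintro (_ | ⟨a, l⟩) h
  · exact absurd rfl h
  · rw [List.nhds_cons_eq_map, Filter.mem_map]
    exact univ_mem' fun p => by simp

instance List.instT3Space {α : Type*} [TopologicalSpace α] [T3Space α] : T3Space (List α) := by
  have h1 : T1Space (List α) := by
    refine ⟨fun l => ?_⟩
    induction l with
    | nil => exact List.isClosed_singleton_nil
    | cons a l ih => simpa using List.isClosed_image2_cons (isClosed_singleton (x := a)) ih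
  have h2 : RegularSpace (List α) := by
    refine RegularSpace.of_exists_mem_nhds_isClosed_subset fun l => ?_
    induction l with
    | nil =>
      intro s hs
      refine ⟨{[]}, by simp, List.isClosed_singleton_nil, ?_⟩
      simpa using hs
    | cons a l ih =>
      intro s hs
      rw [List.nhds_cons_eq_map, Filter.mem_map] at hs
      obtain ⟨u, hu, v, hv, huv⟩ := mem_prod_iff.1 hs
      obtain ⟨u', hu', hu'c, hu'u⟩ := exists_mem_nhds_isClosed_subset hu
      obtain ⟨v', hv', hv'c, hv'v⟩ := ih v hv
      refine ⟨_, ?_, List.isClosed_image2_cons hu'c hv'c, ?_⟩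
      · rw [List.nhds_cons_eq_map, Filter.mem_map]
        exact mem_of_superset (prod_mem_prod hu' hv') fun p hp => ⟨p.1, hp.1, p.2, hp.2, rfl⟩
      · rintro _ ⟨b, hb, m, hm, rfl⟩
        exact huv (show (b, m) ∈ u ×ˢ v from ⟨hu'u hb, hv'v hm⟩)
  exact {}

instance List.instFirstCountableTopology {α : Type*} [TopologicalSpace α]
    [FirstCountableTopology α] : FirstCountableTopology (List α) := by
  refine ⟨fun l => ?_⟩
  induction l with
  | nil => rw [nhds_nil]; infer_instance
  | cons a l ih => rw [List.nhds_cons_eq_map]; infer_instance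

theorem List.continuous_map_smul {G α : Type*} [TopologicalSpace G] [TopologicalSpace α]
    [SMul G α] [ContinuousSMul G α] :
    Continuous fun p : G × List α => p.2.map fun a => p.1 • a := by
  rw [continuous_iff_continuousAt]
  rintro ⟨g, l⟩
  rw [ContinuousAt, nhds_prod_eq]
  induction l with
  | nil => simp
  | cons a l ih =>
    rw [List.nhds_cons_eq_map, ← Filter.map_id (f := 𝓝 g), Filter.prod_map_map_eq, tendsto_map'_iff]
    simp only [Function.comp_def, id, List.map_cons]
    refine Tendsto.cons ?_ ?_
    · have h : Tendsto (fun p : G × α => p.1 • p.2) (𝓝 g ×ˢ 𝓝 a) (𝓝 (g • a)) := by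
        rw [← nhds_prod_eq]
        exact continuous_smul.tendsto (g, a)
      exact h.comp (tendsto_fst.prodMk (tendsto_fst.comp tendsto_snd))
    · exact ih.comp (tendsto_fst.prodMk (tendsto_snd.comp tendsto_snd))

/-! ### The flip group and its action on letters -/

/-- A finite set of columns `k : ℕ`, encoded by its indicator function modulo two. The group
operation is the symmetric difference, written multiplicatively, and the topology is discrete. -/
def FlipPattern : Type := Multiplicative (ℕ →₀ ZMod 2)

namespace FlipPattern

noncomputable instance : CommGroup FlipPattern := inferInstanceAs (CommGroup (Multiplicative (ℕ →₀ ZMod 2)))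

instance : Countable FlipPattern := inferInstanceAs (Countable (ℕ →₀ ZMod 2))

instance : TopologicalSpace FlipPattern := ⊥

instance : DiscreteTopology FlipPattern := ⟨rfl⟩

/-- The coefficient of a pattern at a column. -/
def coeff (a : FlipPattern) (k : ℕ) : ZMod 2 := (Multiplicative.toAdd a : ℕ →₀ ZMod 2) k

/-- The pattern consisting of the single column `k`. -/
noncomputable def single (k : ℕ) : FlipPattern := Multiplicative.ofAdd (Finsupp.single k 1)

@[simp] theorem coeff_one (k : ℕ) : coeff 1 k = 0 := rfl

@[simp] theorem coeff_mul (a b : FlipPattern) (k : ℕ) : coeff (a * b) k = coeff a k + coeff b k :=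
  rfl

@[simp] theorem coeff_single_self (k : ℕ) : coeff (single k) k = 1 := Finsupp.single_eq_same

/-- In the columns of the pattern, exchange `i` and `i + 1` whenever `i + k` is even. The column
`⊤` is always left in place. -/
def flip (a : FlipPattern) (i : ℤ) (k : ℕ∞) : ℤ :=
  if k = ⊤ ∨ coeff a k.toNat = 0 then i else if Even (i + k.toNat) then i + 1 else i - 1

theorem flip_one (i : ℤ) (k : ℕ∞) : flip 1 i k = i := by simp [flip]

theorem flip_mul (a b : FlipPattern) (i : ℤ) (k : ℕ∞) :
    flip (a * b) i k = flip a (flip b i k) k := by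
  have h2 : ∀ x : ZMod 2, x = 0 ∨ x = 1 := by decide
  have h11 : (1 + 1 : ZMod 2) = 0 := by decide
  by_cases hk : k = ⊤
  · simp [flip, hk]
  rcases h2 (coeff a k.toNat) with ha | ha <;> rcases h2 (coeff b k.toNat) with hb | hb <;>
    simp only [flip, hk, coeff_mul, ha, hb, h11, false_or, add_zero, zero_add, if_true,
      one_ne_zero, if_false]
  by_cases he : Even (i + k.toNat)
  · have h' : ¬ Even (i + 1 + k.toNat) := by
      rw [add_right_comm]; simpa [Int.even_add_one] using he
    simp [he, h']
  · have h' : Even (i - 1 + k.toNat) := by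
      rw [sub_add_eq_add_sub]; simpa [Int.even_sub_one] using he
    simp [he, h']

theorem abs_flip_sub_le (a : FlipPattern) (i : ℤ) (k : ℕ∞) : |flip a i k - i| ≤ 1 := by
  unfold flip
  split_ifs <;> simp

theorem continuous_flip : Continuous fun p : FlipPattern × ℤ × ℕ∞ => flip p.1 p.2.1 p.2.2 := by
  refine continuous_prod_of_discrete_left.2 fun a => continuous_prod_of_discrete_left.2 fun i => ?_
  rw [continuous_iff_continuousAt]
  intro k
  by_cases hk : k = ⊤
  · subst hk
    -- A pattern has finitely many columns, so it fixes a neighbourhood of the column `⊤`.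
    have hfix : ∀ᶠ k : ℕ∞ in 𝓝 ⊤, ∀ j ∈ (Multiplicative.toAdd a : ℕ →₀ ZMod 2).support, k ≠ j :=
      (Finset.eventually_all _).2 fun j _ => isOpen_compl_singleton.mem_nhds (ENat.top_ne_natCast j)
    rw [ContinuousAt, show flip a i ⊤ = i by simp [flip]]
    refine tendsto_const_nhds.congr' ?_
    filter_upwards [hfix] with k hk
    refine (if_pos ?_).symm
    by_contra! h
    exact hk k.toNat (Finsupp.mem_support_iff.2 h.2) (ENat.natCast_toNat h.1).symm
  · rw [ContinuousAt, ENat.nhds_eq_pure hk]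
    exact tendsto_pure_left.2 fun s hs => mem_of_mem_nhds hs

end FlipPattern

/-- A letter `(n, i, k)` lies on the spike `n` of a fan, at height `i`, in the column `k`. The
letters with `k = ⊤` are the nodes of the spike, to which the columns converge. -/
abbrev Letter : Type := ℕ × ℤ × ℕ∞

/-- A sequence of patterns, one for each spike, acts on letters by flipping their heights. -/
instance : MulAction (ℕ → FlipPattern) Letter where
  smul g a := (a.1, (g a.1).flip a.2.1 a.2.2, a.2.2)
  one_smul a := by
    change (a.1, FlipPattern.flip 1 a.2.1 a.2.2, a.2.2) = a
    rw [FlipPattern.flip_one]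
  mul_smul g h a := by
    change (a.1, FlipPattern.flip (g a.1 * h a.1) a.2.1 a.2.2, a.2.2) = (a.1, _, a.2.2)
    rw [FlipPattern.flip_mul]
    rfl

theorem Letter.smul_def (g : ℕ → FlipPattern) (a : Letter) :
    g • a = (a.1, (g a.1).flip a.2.1 a.2.2, a.2.2) := rfl

instance : ContinuousSMul (ℕ → FlipPattern) Letter := by
  refine ⟨?_⟩
  have h : Continuous fun p : (ℕ → FlipPattern) × Letter => p.1 p.2.1 := by
    have : Continuous fun p : ℕ × (ℕ → FlipPattern) => p.2 p.1 :=
      continuous_prod_of_discrete_left.2 fun n => continuous_apply n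
    exact this.comp (continuous_snd.fst.prodMk continuous_fst)
  exact continuous_snd.fst.prodMk
    ((FlipPattern.continuous_flip.comp (h.prodMk continuous_snd.snd)).prodMk continuous_snd.snd.snd)

/-! ### The space of words -/

/-- The words over the alphabet of letters. The empty word is the root; `a :: w` is a point of the
fan attached to `w`, the heights `-∞` and `+∞` of this fan being the words `w` and `[]`. This
type carries a coarser topology than `List Letter`. -/
@[ext] structure Word where
  letters : List Letter

/-- Approximation at precision `M`: letters of height below `-M` are regarded as absent, and
letters of height above `M` as leading back to the root. -/
def truncate (M : ℕ) : List Letter → List Letter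
  | [] => []
  | a :: l => if M < a.2.1 then [] else if a.2.1 < -M then truncate M l else a :: truncate M l

theorem continuous_truncate (M : ℕ) : Continuous (truncate M) := by
  rw [continuous_iff_continuousAt]
  refine List.tendsto_nhds ?_ ?_
  · simp [truncate]
  · intro l a ih
    have ha : ∀ᶠ p : Letter × List Letter in 𝓝 a ×ˢ 𝓝 l, p.1.2.1 = a.2.1 := by
      have h : ∀ᶠ b : Letter in 𝓝 a, b.2.1 = a.2.1 := by
        have : Continuous fun b : Letter => b.2.1 := by fun_prop
        exact (this.tendsto a).eventually_mem (isOpen_discrete {a.2.1} |>.mem_nhds rfl)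
      exact tendsto_fst.eventually h
    by_cases h1 : (M : ℤ) < a.2.1
    · refine tendsto_const_nhds.congr' ?_
      filter_upwards [ha] with p hp
      simp [truncate, hp, h1]
    by_cases h2 : a.2.1 < -(M : ℤ)
    · rw [show truncate M (a :: l) = truncate M l by simp [truncate, h1, h2]]
      refine (ih.comp tendsto_snd).congr' ?_
      filter_upwards [ha] with p hp
      simp [truncate, hp, h1, h2]
    · rw [show truncate M (a :: l) = a :: truncate M l by simp [truncate, h1, h2]]
      refine (tendsto_fst.cons (ih.comp tendsto_snd)).congr' ?_
      filter_upwards [ha] with p hp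
      simp [truncate, hp, h1, h2]

/-- Flips change heights by at most one, so that a word truncated at precision `M + 1` determines
the flipped word at precision `M`. -/
theorem truncate_map_smul (M : ℕ) (g : ℕ → FlipPattern) (l : List Letter) :
    truncate M (l.map (g • ·)) = truncate M ((truncate (M + 1) l).map (g • ·)) := by
  induction l with
  | nil => rfl
  | cons a l ih =>
    have h := abs_le.1 (FlipPattern.abs_flip_sub_le (g a.1) a.2.1 a.2.2)
    have hga : (g • a).2.1 = (g a.1).flip a.2.1 a.2.2 := rfl
    by_cases h1 : ((M + 1 : ℕ) : ℤ) < a.2.1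
    · have h1' : (M : ℤ) < (g • a).2.1 := by push_cast at h1; omega
      rw [List.map_cons, truncate, truncate, if_pos h1, if_pos h1']
      rfl
    by_cases h2 : a.2.1 < -((M + 1 : ℕ) : ℤ)
    · have h1' : ¬ (M : ℤ) < (g • a).2.1 := by push_cast at h2; omega
      have h2' : (g • a).2.1 < -(M : ℤ) := by push_cast at h2; omega
      rw [List.map_cons, truncate, truncate, if_neg h1, if_pos h2, if_neg h1', if_pos h2', ih]
    · rw [truncate.eq_2 (M + 1), if_neg h1, if_neg h2, List.map_cons, List.map_cons, truncate,
        truncate, ih]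

theorem eventually_truncate_eq (l : List Letter) : ∀ᶠ M in atTop, truncate M l = l := by
  induction l with
  | nil => exact Eventually.of_forall fun M => rfl
  | cons a l ih =>
    filter_upwards [ih, eventually_ge_atTop a.2.1.natAbs] with M hM ha
    rw [truncate, if_neg (by omega), if_neg (by omega), hM]

namespace Word

/-- The topology that makes all truncations continuous, the truncated words being viewed in the
finer topology of `List Letter`. -/
instance : TopologicalSpace Word :=
  .induced (fun w M => truncate M w.letters) (inferInstanceAs (TopologicalSpace (ℕ → List Letter)))

theorem isEmbedding_truncate : IsEmbedding fun (w : Word) (M : ℕ) => truncate M w.letters := by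
  refine ⟨⟨rfl⟩, fun v w h => ?_⟩
  obtain ⟨M, hv, hw⟩ :=
    ((eventually_truncate_eq v.letters).and (eventually_truncate_eq w.letters)).exists
  have := congrFun h M
  simp only [hv, hw] at this
  exact Word.ext this

theorem continuous_mk : Continuous Word.mk :=
  isEmbedding_truncate.continuous_iff.2 (continuous_pi fun M => continuous_truncate M)

theorem tendsto_nhds_of_eventually_truncate_eq {ι : Type*} {f : Filter ι} {u : ι → Word} {w : Word}
    (h : ∀ M, ∀ᶠ x in f, truncate M (u x).letters = truncate M w.letters) : Tendsto u f (𝓝 w) := by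
  rw [isEmbedding_truncate.tendsto_nhds_iff, tendsto_pi_nhds]
  exact fun M => tendsto_const_nhds.congr' ((h M).mono fun x hx => hx.symm)

/-- The lower ends of the spikes of the fan at `l` converge to `l`, uniformly in the spike. -/
theorem tendsto_cons_atBot (l : List Letter) :
    Tendsto (fun a : Letter => Word.mk (a :: l)) (comap (fun a => a.2.1) atBot) (𝓝 ⟨l⟩) := by
  refine tendsto_nhds_of_eventually_truncate_eq fun M => ?_
  filter_upwards [tendsto_comap.eventually (eventually_lt_atBot (-(M : ℤ)))] with a ha
  simp only [truncate]
  rw [if_neg (by omega), if_pos ha]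

/-- The upper ends of the spikes of any fan converge to the root, uniformly in the spike. -/
theorem tendsto_cons_atTop (l : List Letter) :
    Tendsto (fun a : Letter => Word.mk (a :: l)) (comap (fun a => a.2.1) atTop) (𝓝 ⟨[]⟩) := by
  refine tendsto_nhds_of_eventually_truncate_eq fun M => ?_
  filter_upwards [tendsto_comap.eventually (eventually_gt_atTop (M : ℤ))] with a ha
  simp only [truncate]
  rw [if_pos ha]

instance : Countable Word :=
  Function.Injective.countable (f := Word.letters) fun _ _ h => Word.ext h

instance : Nonempty Word := ⟨⟨[]⟩⟩

instance : MetrizableSpace Word := by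
  have : T3Space Word := isEmbedding_truncate.t3Space
  have : FirstCountableTopology Word := isEmbedding_truncate.isInducing.firstCountableTopology
  exact metrizableSpace_of_t3_secondCountable Word

instance (w : Word) : NeBot (𝓝[≠] w) := by
  have h : Tendsto (fun j : ℕ => Word.mk ((0, -(j : ℤ), ⊤) :: w.letters)) atTop (𝓝 w) :=
    (tendsto_cons_atBot w.letters).comp
      (tendsto_comap_iff.2 (tendsto_neg_atTop_atBot.comp tendsto_natCast_atTop_atTop))
  have hne : ∀ j : ℕ, Word.mk ((0, -(j : ℤ), ⊤) :: w.letters) ∈ ({w}ᶜ : Set Word) := by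
    intro j hj
    simpa using congrArg (fun v : Word => v.letters.length) hj
  exact (tendsto_nhdsWithin_iff.2 ⟨h, Eventually.of_forall hne⟩).neBot

instance : MulAction (ℕ → FlipPattern) Word where
  smul g w := ⟨w.letters.map (g • ·)⟩
  one_smul w := Word.ext (by change w.letters.map _ = _; simp)
  mul_smul g h w := Word.ext (by
    change w.letters.map _ = (w.letters.map _).map _
    simp [mul_smul, Function.comp_def])

theorem letters_smul (g : ℕ → FlipPattern) (w : Word) :
    (g • w).letters = w.letters.map (g • ·) := rfl

instance : ContinuousSMul (ℕ → FlipPattern) Word := by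
  refine ⟨isEmbedding_truncate.continuous_iff.2 (continuous_pi fun M => ?_)⟩
  simp only [Function.comp_def, letters_smul]
  have h : Continuous fun w : Word => truncate (M + 1) w.letters :=
    (continuous_apply (M + 1)).comp isEmbedding_truncate.continuous
  refine ((continuous_truncate M).comp (List.continuous_map_smul.comp (continuous_fst.prodMk (h.comp continuous_snd)))).congr fun p => ?_
  exact (truncate_map_smul M p.1 p.2.letters).symm

end Word

/-! ### Gluing all points of a compactification -/

/-- The countable group of sequences of patterns of which all but finitely many are trivial, with
the topology of the product of the discrete groups of patterns. -/
def FlipGroup : Subgroup (ℕ → FlipPattern) where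
  carrier := {g | (Function.mulSupport g).Finite}
  one_mem' := by simp
  mul_mem' hg hh := (hg.union hh).subset (Function.mulSupport_mul _ _)
  inv_mem' hg := by simpa [Function.mulSupport_inv] using hg

instance : Countable FlipGroup := by
  have h : Function.Injective fun g : FlipGroup =>
      Finsupp.ofSupportFinite (fun n => Multiplicative.toAdd (g.1 n : Multiplicative (ℕ →₀ ZMod 2)))
        g.2 := by
    intro g h hgh
    refine Subtype.ext (funext fun n => ?_)
    exact DFunLike.congr_fun hgh n
  exact h.countable

instance : MetrizableSpace FlipGroup := by
  have : FirstCountableTopology FlipGroup :=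
    (IsInducing.subtypeVal (t := {g | g ∈ FlipGroup})).firstCountableTopology
  exact metrizableSpace_of_t3_secondCountable FlipGroup

/-- The flip of the single column `k` on all spikes with label `n`. -/
noncomputable def singleFlip (n k : ℕ) : FlipGroup :=
  ⟨Pi.mulSingle n (FlipPattern.single k), (finite_singleton n).subset Pi.mulSupport_mulSingle_subset⟩

theorem singleFlip_apply_of_ne {m n : ℕ} (h : m ≠ n) (k : ℕ) : (singleFlip n k).1 m = 1 :=
  Pi.mulSingle_eq_of_ne h _

/-- On words in which the label `n` does not occur, `singleFlip n k` acts trivially, so that it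
moves only the first letter here. -/
theorem singleFlip_smul_cons {n k : ℕ} {j : ℤ} (hj : Even (j + k)) {l : List Letter}
    (hl : ∀ a ∈ l, a.1 < n) :
    singleFlip n k • Word.mk ((n, j, (k : ℕ∞)) :: l) = ⟨(n, j + 1, (k : ℕ∞)) :: l⟩ := by
  refine Word.ext ?_
  change ((singleFlip n k).1 • Word.mk _).letters = _
  rw [Word.letters_smul, List.map_cons]
  congr 1
  · simp [Letter.smul_def, singleFlip, FlipPattern.flip, hj]
  · conv_rhs => rw [← List.map_id l]
    refine List.map_congr_left fun a ha => ?_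
    rw [Letter.smul_def, singleFlip_apply_of_ne (hl a ha).ne, FlipPattern.flip_one]
    rfl

/-- A real function on words is *slowly moved* if elements of the group that are close to the
identity change its values uniformly little. Such are the functions that come from equivariant
compactifications. -/
def IsSlowlyMoved (φ : Word → ℝ) : Prop :=
  ∀ ε > 0, ∃ N, ∀ g : FlipGroup, (∀ n < N, g.1 n = 1) → ∀ w, |φ (g • w) - φ w| ≤ ε

/-- Consecutive nodes of the `n`-th spike are limits of columns exchanged by elements of the
group that are close to the identity for large `n`. -/
theorem IsSlowlyMoved.tendsto_node_succ {φ : Word → ℝ} (hs : IsSlowlyMoved φ)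
    (hφ : Continuous φ) (l : List Letter) (j : ℤ) :
    Tendsto (fun n : ℕ => φ ⟨(n, j + 1, ⊤) :: l⟩ - φ ⟨(n, j, ⊤) :: l⟩) atTop (𝓝 0) := by
  rw [Metric.tendsto_nhds]
  intro ε hε
  obtain ⟨N, hN⟩ := hs (ε / 2) (half_pos hε)
  have hl : ∀ᶠ n : ℕ in atTop, ∀ a ∈ l, a.1 < n :=
    l.finite_toSet.eventually_all.2 fun a _ => eventually_gt_atTop a.1
  filter_upwards [hl, eventually_ge_atTop N] with n hln hNn
  rw [Real.dist_0_eq_abs]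
  refine lt_of_le_of_lt ?_ (half_lt_self hε)
  -- The columns `k` of the parity of `j`, in which the heights `j` and `j + 1` are exchanged.
  let k : ℕ → ℕ := fun m => 2 * m + j.natAbs
  have hk : Tendsto (fun m => (k m : ℕ∞)) atTop (𝓝 ⊤) :=
    ENat.tendsto_natCast_nhds_top.comp
      (tendsto_atTop_mono (fun m => by dsimp only [k, id]; omega) tendsto_id)
  have hlim : ∀ i : ℤ, Tendsto (fun m => φ ⟨(n, i, (k m : ℕ∞)) :: l⟩) atTop
      (𝓝 (φ ⟨(n, i, ⊤) :: l⟩)) := by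
    intro i
    have hc : Continuous fun c : ℕ∞ => φ ⟨((n, i, c) : Letter) :: l⟩ :=
      hφ.comp (Word.continuous_mk.comp (List.continuous_cons.comp
        (show Continuous fun c : ℕ∞ => (((n, i, c) : Letter), l) by fun_prop)))
    exact (hc.tendsto ⊤).comp hk
  refine le_of_tendsto ((hlim (j + 1)).sub (hlim j)).abs (Eventually.of_forall fun m => ?_)
  have hj : Even (j + (k m : ℤ)) := by
    rw [Int.even_iff]
    dsimp only [k]
    omega
  rw [← singleFlip_smul_cons hj hln]
  exact hN _ (fun i hi => singleFlip_apply_of_ne (by omega) _) _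

theorem IsSlowlyMoved.tendsto_node_add {φ : Word → ℝ} (hs : IsSlowlyMoved φ)
    (hφ : Continuous φ) (l : List Letter) (j : ℤ) (m : ℕ) :
    Tendsto (fun n : ℕ => φ ⟨(n, j + m, ⊤) :: l⟩ - φ ⟨(n, j, ⊤) :: l⟩) atTop (𝓝 0) := by
  induction m with
  | zero => simp
  | succ m ih =>
    have h := (hs.tendsto_node_succ hφ l (j + m)).add ih
    simpa [add_assoc] using h

/-- The number of steps along a spike from a neighbourhood of `l` to a neighbourhood of the root
does not depend on the spike, while on distant spikes each single step becomes negligible. -/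
theorem IsSlowlyMoved.eq_root {φ : Word → ℝ} (hs : IsSlowlyMoved φ)
    (hφ : Continuous φ) (w : Word) : φ w = φ ⟨[]⟩ := by
  obtain ⟨l⟩ := w
  refine eq_of_forall_dist_le fun ε hε => ?_
  have hε3 : 0 < ε / 3 := by positivity
  have hbot := Metric.tendsto_nhds.1 ((hφ.tendsto _).comp (Word.tendsto_cons_atBot l)) _ hε3
  have htop := Metric.tendsto_nhds.1 ((hφ.tendsto _).comp (Word.tendsto_cons_atTop l)) _ hε3
  rw [eventually_comap] at hbot htop
  obtain ⟨j, hj⟩ := hbot.exists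
  obtain ⟨i, hji, hi⟩ := ((eventually_ge_atTop j).and htop).exists
  obtain ⟨m, rfl⟩ := Int.le.dest hji
  obtain ⟨n, hn⟩ := (Metric.tendsto_nhds.1 (hs.tendsto_node_add hφ l j m) _ hε3).exists
  have h1 := hj (n, j, ⊤) rfl
  have h2 := hi (n, j + m, ⊤) rfl
  simp only [Function.comp_apply, Real.dist_eq, sub_zero] at h1 h2 hn ⊢
  rw [abs_lt] at h1 h2 hn
  rw [abs_le]
  constructor <;> linarith [h1.1, h1.2, h2.1, h2.2, hn.1, hn.2]

/-- By compactness, group elements close to the identity move all points of `K` uniformly little,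
as measured by a continuous function. -/
theorem isSlowlyMoved_comp {K : Type*} [TopologicalSpace K] [CompactSpace K]
    [MulAction FlipGroup K] [ContinuousSMul FlipGroup K] {i : Word → K}
    (hi : ∀ (g : FlipGroup) w, i (g • w) = g • i w) {F : K → ℝ} (hF : Continuous F) :
    IsSlowlyMoved (F ∘ i) := by
  intro ε hε
  have hc : Continuous fun p : FlipGroup × K => |F (p.1 • p.2) - F p.2| := by fun_prop
  have h : ∀ᶠ g : FlipGroup in 𝓝 1, ∀ y ∈ (univ : Set K), |F (g • y) - F y| < ε := by
    refine isCompact_univ.eventually_forall_of_forall_eventually fun y _ => ?_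
    exact (hc.tendsto (1, y)).eventually_lt_const (by simpa using hε)
  rw [nhds_subtype, eventually_comap, nhds_pi] at h
  obtain ⟨I, hI, t, ht, hsub⟩ := mem_pi.1 h
  obtain ⟨N, hN⟩ := hI.bddAbove
  refine ⟨N + 1, fun g hg w => ?_⟩
  have hgI : g.1 ∈ I.pi t := fun n hn => by
    rw [hg n (Nat.lt_succ_of_le (hN hn))]
    exact mem_of_mem_nhds (ht n)
  rw [Function.comp_apply, Function.comp_apply, hi]
  exact (hsub hgI g rfl (i w) (mem_univ _)).le

theorem IsEquivariantCompactification.eq_of_word {K : Type*} [TopologicalSpace K]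
    [MulAction FlipGroup K] {i : Word → K} (hi : IsEquivariantCompactification FlipGroup i)
    (y : K) : y = i ⟨[]⟩ := by
  have := hi.compactSpace
  have := hi.t2Space
  have := hi.continuousSMul
  have hconst : ∀ w, i w = i ⟨[]⟩ := by
    intro w
    by_contra hne
    obtain ⟨F, hF0, hF1, -⟩ := exists_continuous_zero_one_of_isClosed
      (isClosed_singleton (x := i w)) (isClosed_singleton (x := i ⟨[]⟩)) (by simpa using hne)
    have h := (isSlowlyMoved_comp hi.equivariant F.continuous).eq_root
      (F.continuous.comp hi.continuous) w
    simp only [Function.comp_apply, hF0 rfl, hF1 rfl] at h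
    exact zero_ne_one h
  have hclosed : IsClosed ({i ⟨[]⟩} : Set K) := isClosed_singleton
  refine hclosed.closure_subset_iff.2 ?_ (hi.denseRange y)
  rintro _ ⟨w, rfl⟩
  exact hconst w

theorem mainTheorem1 :
    ∃ (G : Type) (_ : Group G) (_ : TopologicalSpace G) (_ : MulAction G ℚ),
      IsTopologicalGroup G ∧ Countable G ∧ TopologicalSpace.SeparableSpace G ∧
      TopologicalSpace.MetrizableSpace G ∧ ContinuousSMul G ℚ ∧
      ∀ (K : Type u) [TopologicalSpace K] [MulAction G K] (i : ℚ → K),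
        IsEquivariantCompactification G i → ∃ k : K, ∀ y : K, y = k := by
  obtain ⟨e⟩ := nonempty_homeomorph_rat Word
  let : MulAction FlipGroup ℚ := e.symm.toEquiv.mulAction FlipGroup
  have hsmul : ∀ (g : FlipGroup) (w : Word), e (g • w) = g • e w := fun g w => by
    change e (g • w) = e (g • e.symm (e w))
    rw [e.symm_apply_apply]
  refine ⟨FlipGroup, inferInstance, inferInstance, inferInstance, inferInstance, inferInstance,
    inferInstance, inferInstance, ⟨?_⟩, fun K _ _ i hi => ⟨i (e ⟨[]⟩), fun y => ?_⟩⟩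
  · change Continuous fun p : FlipGroup × ℚ => e (p.1 • e.symm p.2)
    exact e.continuous.comp (continuous_fst.smul (e.symm.continuous.comp continuous_snd))
  · refine IsEquivariantCompactification.eq_of_word (i := i ∘ e)
      ⟨hi.compactSpace, hi.t2Space, hi.continuousSMul, hi.continuous.comp e.continuous,
        fun g w => ?_, hi.denseRange.comp e.surjective.denseRange hi.continuous⟩ y
    rw [Function.comp_apply, hsmul, hi.equivariant, Function.comp_apply]
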